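/- **Notation.** Let $\Delta(\tau)=q\prod_{n\ge1}(1-q^n)^{24}$ ($q=e^{2\pi i\tau}$) be the modular discriminant on the upper half-plane $\mathbb H$, $c_4=E_4=1+240q+\cdots$, $j=c_4^3/\Delta$, and $g_\infty(\tau)=-\log\big((4\pi\,\mathrm{Im}\,\tau)^6|\Delta(\tau)|\big)$. *Faltings' height.* For an elliptic curve $E$ over a number field $K$ with minimal discriminant $\Delta_{E/K}$, put $$h_F(E/K)=\frac1{12[K:\mathbb Q]}\Big(\log|N_{K/\mathbb Q}(\Delta_{E/K})|+\sum_{\sigma:K\to\mathbb C}g_\infty(\tau_\sigma)\Big),$$ where $\tau_\sigma\in\mathbb H$ is such that $E_\sigma(\mathbb C)\cong\mathbb C/(\mathbb Z+\tau_\sigma\mathbb Z)$. For $\alpha\in\overline{\mathbb Q}$ put $h_F(\alpha)=h_F(E/L)$, where $L$ is a number field containing $\alpha$ and $E/L$ is a semistable elliptic curve with $j(E)=\alpha$. The essential minimum is $\mu_F^{\rm ess}=\inf\{\theta\in\mathbb R:\{\alpha\in\overline{\mathbb Q}:h_F(\alpha)\le\theta\}\text{ is infinite}\}$. *The metrized line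 bundle.* On $\mathcal X=\mathbb P^1_{\mathbb Z}$ with homogeneous coordinates $[\zeta_0:\zeta_1]$ let $\mathcal L=\mathcal O(D_\infty)$, $\infty=[1:0]$; the global sections of $\mathcal L^{\otimes n}$ are the homogeneous forms of degree $n$ in $\mathbb Z[\zeta_0,\zeta_1]$. Identify $\mathrm{SL}_2(\mathbb Z)\backslash\mathbb H\cup\{\infty\}$ with $\mathcal X(\mathbb C)$ by $\tau\mapsto[c_4(\tau)^3:\Delta(\tau)]$, and a section $P$ of $\mathcal L^{\otimes n}$ with the modular form $P(c_4^3,\Delta)$ of weight $12n$; its Petersson norm at the image of $\tau$ is $\|P\|_{\rm Pet}=(4\pi\,\mathrm{Im}\,\tau)^{6n}|P(c_4(\tau)^3,\Delta(\tau))|$, and at $\infty$ it is the limit of this for $\mathrm{Im}\,\tau\to\infty$, in $[0,\infty]$. At a finite place $v$ the norm is $\|P(\zeta)\|_v=|P(\zeta_0,\zeta_1)|_v/\max(|\zeta_0|_v,|\zeta_1|_v)^n$. For $x\in\overline{\mathbb Q}$, seen as the point $[x:1]$, a number field $K\ni x$ and a section $P$ of $\mathcal L$ with $P(x)\neq0$,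 the height is $$h_{\overline{\mathcal L}}(x)=\frac1{[K:\mathbb Q]}\Big(\sum_{v\nmid\infty}-\log\|P(x)\|_v+\sum_{\sigma:K\to\mathbb C}-\log\|P(\sigma(x))\|_{\rm Pet}\Big),$$ with $|\cdot|_v$ normalized so that the product formula holds; it does not depend on $K$ and $P$. *Real sections.* A real global section is a formal product $s=s_1^{\otimes a_1}\otimes\cdots\otimes s_\ell^{\otimes a_\ell}$ with real $a_k>0$ and nonzero $s_k\in\Gamma(\mathcal X,\mathcal L^{\otimes n_k})$. Its weight is $12(a_1n_1+\cdots+a_\ell n_\ell)$ (so that $\Delta$ has weight $12$ and $\Delta^{1/12}$ has weight one), $|\mathrm{div}(s)|\subset\mathcal X(\overline{\mathbb Q})$ is the union of the zero sets of the $s_k$, $\|s\|_{\rm Pet}=\prod_k\|s_k\|_{\rm Pet}^{a_k}$ (with $0\cdot\infty=0$ at the point $\infty$), and $g_s=-\log\|s\|_{\rm Pet}:\mathcal X(\mathbb C)\to[-\infty,\infty]$. **Proposition.** Let $s$ be a real global section of weight one. For every $x\in\overline{\mathbb Q}$ with $x\notin|\mathrm{div}(s)|$, $$h_F(x)=\tfrac1{12}h_{\overline{\mathcal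 L}}(x)\ \ge\ \inf_{y\in\mathcal X(\mathbb C)}g_s(y)=-\log\sup_{y\in\mathcal X(\mathbb C)}\|s(y)\|_{\rm Pet}.$$ In particular $\mu_F^{\rm ess}\ge\inf_{y\in\mathcal X(\mathbb C)}g_s(y)$. -/

import Mathlib

open NumberField IsDedekindDomain UpperHalfPlane
open scoped ENNReal

noncomputable section

namespace FaltingsEssMin

/-- The field of algebraic numbers. -/
abbrev Qbar : Type := AlgebraicClosure ℚ

instance : Algebra.IsAlgebraic ℚ Qbar := AlgebraicClosure.isAlgebraic ℚ

/-! ### Modular functions of level one -/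

/-- The `j`-invariant `j = c₄³ / Δ = 1/q + 744 + ⋯`, where `c₄ = E₄ = 1 + 240 q + ⋯` and
`Δ = q ∏ (1 - qⁿ)²⁴`. -/
def jInv (τ : ℍ) : ℂ := (ModularForm.E₄ τ) ^ 3 / ModularForm.discriminant τ

/-- The hyperbolic Green function `g_∞(τ) = - log ((4π Im τ)⁶ |Δ(τ)|)`. -/
def gInf (τ : ℍ) : ℝ :=
  -Real.log ((4 * Real.pi * τ.im) ^ 6 * ‖ModularForm.discriminant τ‖)

/-! ### Elliptic curves over the complex numbers -/

theorem indep_one_tau (τ : ℍ) : LinearIndependent ℝ ![(1 : ℂ), (τ : ℂ)] := by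
  rw [LinearIndependent.pair_iff]
  intro a b h
  have him : (a • (1 : ℂ) + b • (τ : ℂ)).im = 0 := by rw [h]; simp
  have hb : b = 0 := by
    have h2 : b * τ.im = 0 := by simpa using him
    exact (mul_eq_zero.mp h2).resolve_right τ.im_pos.ne'
  subst hb
  have hre : (a • (1 : ℂ) + (0 : ℝ) • (τ : ℂ)).re = 0 := by rw [h]; simp
  exact ⟨by simpa using hre, rfl⟩

/-- The pair of periods `1, τ`, spanning the lattice `ℤ + τ ℤ`. -/
def periodPair (τ : ℍ) : PeriodPair := ⟨1, (τ : ℂ), indep_one_tau τ⟩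

/-- The elliptic curve `ℂ / (ℤ + τ ℤ)` in its Weierstrass form
`Y² = X³ - (g₂/4) X - g₃/4`, with `X = ℘(z)` and `Y = ℘'(z)/2`. -/
def torusCurve (τ : ℍ) : WeierstrassCurve ℂ :=
  ⟨0, 0, 0, -(periodPair τ).g₂ / 4, -(periodPair τ).g₃ / 4⟩

/-- The map `z ↦ (℘(z), ℘'(z)/2)` sends `ℂ / (ℤ + τ ℤ)`, minus the origin, to the curve. -/
theorem torusCurve_equation (τ : ℍ) (z : ℂ) (hz : z ∉ (periodPair τ).lattice) :
    (torusCurve τ).toAffine.Equation ((periodPair τ).weierstrassP z)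
      ((periodPair τ).derivWeierstrassP z / 2) := by
  have h := (periodPair τ).derivWeierstrassP_sq z hz
  rw [WeierstrassCurve.Affine.equation_iff]
  simp only [torusCurve]
  linear_combination h / 4

/-- `E(ℂ) ≅ ℂ / (ℤ + τ ℤ)`. -/
def IsUniformizedBy (E : WeierstrassCurve ℂ) (τ : ℍ) : Prop :=
  ∃ C : WeierstrassCurve.VariableChange ℂ, C • E = torusCurve τ

/-- A chosen `τ` in the upper half plane with `E(ℂ) ≅ ℂ / (ℤ + τ ℤ)`. -/
def periodPoint (E : WeierstrassCurve ℂ) : ℍ :=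
  Classical.epsilon fun τ => IsUniformizedBy E τ

/-! ### Faltings' height of an elliptic curve over a number field -/

section NumberFields

variable {K : Type*} [Field K] [NumberField K]

/-- The discrete valuation ring of `v`-integral elements of the number field `K`. -/
abbrev localRing (v : HeightOneSpectrum (𝓞 K)) : ValuationSubring K :=
  (v.valuation K).valuationSubring

instance (v : HeightOneSpectrum (𝓞 K)) : IsDiscreteValuationRing (localRing v) :=
  (v.valuation K).valuationSubring_isDiscreteValuationRing

/-- The exponent at `v` of the minimal discriminant: the order at `v` of the discriminant of a
Weierstrass equation of `E` that is minimal at `v`. -/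
def minDiscExponent (E : WeierstrassCurve K) (v : HeightOneSpectrum (𝓞 K)) : ℕ :=
  (-WithZero.log (v.valuation K (E.minimal (localRing v)).Δ)).toNat

/-- The minimal discriminant `Δ_{E/K}`, an ideal of the ring of integers. -/
def minimalDiscriminant (E : WeierstrassCurve K) : Ideal (𝓞 K) :=
  ∏ᶠ v : HeightOneSpectrum (𝓞 K), v.asIdeal ^ minDiscExponent E v

/-- `E/K` is semistable: at every finite place it has good or multiplicative reduction. -/
def IsSemistable (E : WeierstrassCurve K) : Prop :=
  ∀ v : HeightOneSpectrum (𝓞 K),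
    (E.minimal (localRing v)).HasGoodReduction (localRing v) ∨
      (E.minimal (localRing v)).HasMultiplicativeReduction (localRing v)

/-- Faltings' height `h_F(E/K)`. -/
def faltingsHeightCurve (E : WeierstrassCurve K) : ℝ :=
  1 / (12 * (Module.finrank ℚ K : ℝ)) *
    (Real.log (Ideal.absNorm (minimalDiscriminant E) : ℝ) +
      ∑ σ : K →+* ℂ, gInf (periodPoint (E.map σ)))

end NumberFields

/-- The (stable) Faltings height `h_F(α)` of an algebraic number `α`: the height `h_F(E/L)` of a
semistable elliptic curve `E` over a number field `L` containing `α` with `j(E) = α`. -/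
def faltingsHeight (α : Qbar) : ℝ :=
  Classical.epsilon fun h : ℝ =>
    ∃ (L : IntermediateField ℚ Qbar) (_ : NumberField L) (E : WeierstrassCurve L)
      (_ : E.IsElliptic), IsSemistable E ∧ ((E.j : L) : Qbar) = α ∧ h = faltingsHeightCurve E

/-- The essential minimum of Faltings' height (an infimum of real numbers, taken in `[-∞, ∞]`). -/
def essentialMinimum : EReal :=
  sInf ((fun θ : ℝ => (θ : EReal)) '' {θ : ℝ | {α : Qbar | faltingsHeight α ≤ θ}.Infinite})

/-! ### The projective line over `ℤ` and the sections of the powers of `𝓛 = O(D_∞)` -/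

/-- Homogeneous coordinates on the projective line `F ∪ {∞}`: the point `ζ` is `[ζ : 1]` and the
point `∞` is `[1 : 0]`. -/
def coords {F : Type*} [Field F] : OnePoint F → Fin 2 → F
  | some ζ => ![ζ, 1]
  | none => ![1, 0]

/-- A nonzero global section over `ℙ¹_ℤ` of the power `𝓛^{⊗ deg}`: a nonzero homogeneous
polynomial of degree `deg` in the two homogeneous coordinates, with integral coefficients. -/
structure IntegralSection where
  /-- the power of `𝓛` -/
  deg : ℕ
  /-- the homogeneous form -/
  form : MvPolynomial (Fin 2) ℤ
  isHomogeneous : form.IsHomogeneous deg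
  ne_zero : form ≠ 0

namespace IntegralSection

/-- The section of `𝓛` corresponding to the modular form `Δ`: the second coordinate. -/
def delta : IntegralSection :=
  ⟨1, MvPolynomial.X 1, MvPolynomial.isHomogeneous_X ℤ 1, MvPolynomial.X_ne_zero 1⟩

/-- The points of `ℙ¹` over the algebraic numbers at which the section vanishes. -/
def support (s : IntegralSection) : Set (OnePoint Qbar) :=
  {x | MvPolynomial.aeval (coords x) s.form = 0}

/-- The canonical norm of a section at a finite place, at a `K`-point `x` of `ℙ¹`. -/
def canNorm {K : Type*} [Field K] [NumberField K] (s : IntegralSection) (v : FinitePlace K)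
    (x : OnePoint K) : ℝ :=
  v (MvPolynomial.aeval (coords x) s.form) / max (v (coords x 0)) (v (coords x 1)) ^ s.deg

/-- The Petersson norm at `τ` of the modular form of weight `12 deg` that corresponds to the
section, under `τ ↦ [c₄(τ)³ : Δ(τ)]`. -/
def petNormUpper (s : IntegralSection) (τ : ℍ) : ℝ :=
  (4 * Real.pi * τ.im) ^ (6 * s.deg) *
    ‖MvPolynomial.aeval ![(ModularForm.E₄ τ) ^ 3, ModularForm.discriminant τ] s.form‖

/-- The Petersson norm of a section at a point of `ℙ¹(ℂ)`. At `ζ = j(τ)` this is the norm at `τ`;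
at the point `∞`, where the metric is singular, it is the limit at the cusp, in `[0, ∞]`. -/
def petNorm (s : IntegralSection) : OnePoint ℂ → ℝ≥0∞
  | some ζ => ENNReal.ofReal (s.petNormUpper (Classical.epsilon fun τ : ℍ => jInv τ = ζ))
  | none => Filter.limsup (fun τ : ℍ => ENNReal.ofReal (s.petNormUpper τ)) atImInfty

end IntegralSection

/-! ### The Arakelov height -/

/-- The normalized sum of the local contributions `-log ‖s(ζ)‖_v` over all the places of `K`; an
archimedean place counts once for each embedding into `ℂ` that induces it. -/
def arakelovSum {K : Type*} [Field K] [NumberField K] (s : IntegralSection) (ζ : K) : ℝ :=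
  1 / (Module.finrank ℚ K : ℝ) *
    ((∑ᶠ v : FinitePlace K, -Real.log (s.canNorm v (ζ : OnePoint K))) +
      ∑ σ : K →+* ℂ, -Real.log (s.petNorm ((σ ζ : ℂ) : OnePoint ℂ)).toReal)

instance (α : Qbar) : NumberField (IntermediateField.adjoin ℚ {α}) := by
  have : FiniteDimensional ℚ (IntermediateField.adjoin ℚ {α}) :=
    IntermediateField.adjoin.finiteDimensional (Algebra.IsIntegral.isIntegral α)
  exact { to_charZero := inferInstance, to_finiteDimensional := inferInstance }

/-- The height of the point `[α : 1]` with respect to the metrized line bundle `𝓛`, computed over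
the number field `ℚ(α)` with the section `Δ`, which does not vanish at `[α : 1]`. (By the product
formula another number field or another section gives the same value.) -/
def arakelovHeight (α : Qbar) : ℝ :=
  arakelovSum IntegralSection.delta (IntermediateField.AdjoinSimple.gen ℚ α)

/-! ### Real global sections -/

/-- A real global section `s₁^{⊗ a₁} ⊗ ⋯ ⊗ s_ℓ^{⊗ a_ℓ}` with `a₁, …, a_ℓ > 0`, given by a
representation of it. -/
structure RealSection where
  /-- the number of factors -/
  len : ℕ
  /-- the factors -/
  factor : Fin len → IntegralSection
  /-- the exponents -/
  exponent : Fin len → ℝ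
  exponent_pos : ∀ k, 0 < exponent k

namespace RealSection

/-- The weight, normalized as for modular forms: the section `Δ` has weight `12`. -/
def weight (s : RealSection) : ℝ := 12 * ∑ k, s.exponent k * ((s.factor k).deg : ℝ)

/-- The support of the divisor. -/
def support (s : RealSection) : Set (OnePoint Qbar) := ⋃ k, (s.factor k).support

/-- The Petersson norm `∏ ‖s_k‖^{a_k}`, with values in `[0, ∞]`. -/
def petNorm (s : RealSection) (y : OnePoint ℂ) : ℝ≥0∞ :=
  ∏ k, ((s.factor k).petNorm y) ^ (s.exponent k)

/-- The Green function `g_s = - log ‖s‖`, with values in `[-∞, ∞]`. -/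
def green (s : RealSection) (y : OnePoint ℂ) : EReal := -ENNReal.log (s.petNorm y)

end RealSection

end FaltingsEssMin

end

/-! At a place of good or multiplicative reduction, `c₄` or `Δ` of a minimal equation is a unit, so
`j = c₄³/Δ` gives |Δ_min|_v⁻¹ = max(1, |j|_v). The finite part of h_F(E/K) for semistable E is thus
the sum of log max(1, |j|_v), which is the finite part of the height of [j : 1] computed with the
section Δ. The archimedean parts agree too, since -log ‖Δ‖_Pet = g_∞ and τ_σ satisfies j(τ_σ) =
σ(j). Hence h_F(E/K) is one twelfth of the Arakelov sum (`faltingsHeightCurve_eq`), and the latter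
does not change under field extension (`arakelovSum_delta_algebraMap`). The choices in the
definitions are meaningful because j maps ℍ onto ℂ (`jInv_surjective`) and every algebraic number is
the j-invariant of a semistable curve (`exists_semistable`).

For the lower bound, a form P of degree n with integral coefficients satisfies |P(x,1)|_v ≤ max(1,
|x|_v)ⁿ at finite places. With the product formula, n times the height is at least the average of
-log ‖P‖_Pet over the conjugates of x (`deg_mul_arakelovSum_ge`). Weighting by the exponents, with ∑
a_k n_k = 1/12, bounds the average of g_s by h_F(x), so g_s ≤ h_F(x) at some conjugate. Only
finitely many algebraic numbers lie on the divisor of s, whence the bound for the essential minimum.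
-/

noncomputable section

namespace FaltingsEssMin

/-! ### The `j`-invariant takes every complex value -/

open Filter Topology ModularForm MatrixGroups in
theorem tendsto_E₄_atImInfty : Tendsto (fun τ : ℍ => E₄ τ) atImInfty (𝓝 1) := by
  have hval : valueAtInfty (E₄ : ℍ → ℂ) = 1 := by
    have h0 := EisensteinSeries.E_qExpansion_coeff_zero (k := 4) (by norm_num) (by decide)
    rw [← h0, qExpansion_coeff_zero one_pos
      (ModularFormClass.analyticAt_cuspFunction_zero E₄ one_pos one_mem_strictPeriods_SL)
      (SlashInvariantFormClass.periodic_comp_ofComplex E₄ one_mem_strictPeriods_SL)]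
  obtain ⟨c, hc, hO⟩ := ModularFormClass.exp_decay_sub_atImInfty' E₄
  rw [hval] at hO
  have hexp : Tendsto (fun τ : ℍ => Real.exp (-c * τ.im)) atImInfty (𝓝 0) := by
    refine Real.tendsto_exp_atBot.comp ?_
    exact (tendsto_comap : Tendsto UpperHalfPlane.im atImInfty atTop).const_mul_atTop_of_neg
      (neg_lt_zero.mpr hc)
  have := hO.trans_tendsto hexp
  simpa using this.add_const 1

-- If j omitted ζ, then E₄³ - ζΔ would have no zero on ℍ and would tend to 1 at the cusp. The
-- quotient Δ/(E₄³ - ζΔ) would be a modular form of level one and weight 0, hence constant, with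
-- limit 0 at the cusp; but Δ never vanishes.
open Filter Topology ModularForm MatrixGroups CongruenceSubgroup OnePoint in
theorem jInv_surjective : Function.Surjective jInv := by
  intro ζ
  by_contra! hζ
  have hf0 : ∀ τ : ℍ, E₄ τ ^ 3 - ζ * discriminant τ ≠ 0 := by
    intro τ h
    refine hζ τ ?_
    rw [jInv, div_eq_iff (discriminant_ne_zero τ)]
    exact sub_eq_zero.mp h
  let f : ModularForm 𝒮ℒ 12 :=
    ModularForm.mcast (by decide) (E₄.pow 3) -
      ζ • (CuspForm.discriminant : ModularForm 𝒮ℒ 12)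
  have hf : ∀ τ : ℍ, f τ = E₄ τ ^ 3 - ζ * discriminant τ := fun τ => rfl
  have hlim : Tendsto (fun τ : ℍ => discriminant τ / f τ) atImInfty (𝓝 0) := by
    have h1 : Tendsto (fun τ : ℍ => f τ) atImInfty (𝓝 1) := by
      have := (tendsto_E₄_atImInfty.pow 3).sub
        ((discriminant_isZeroAtImInfty : Tendsto _ _ _).const_mul ζ)
      simpa [hf] using this
    have := (discriminant_isZeroAtImInfty : Tendsto _ _ _).div h1 one_ne_zero
    rwa [zero_div] at this
  have hslash : ∀ γ : SL(2, ℤ), (fun τ => discriminant τ / f τ) ∣[(0 : ℤ)] γ =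
      fun τ => discriminant τ / f τ := by
    intro γ
    have hγ : (γ : GL (Fin 2) ℝ) ∈ 𝒮ℒ := ⟨γ, rfl⟩
    change (⇑CuspForm.discriminant / ⇑f) ∣[(12 - 12 : ℤ)] γ = ⇑CuspForm.discriminant / ⇑f
    simp_rw [div_slash_SL2, SL_slash, SlashInvariantForm.slash_action_eqn _ _ hγ]
  let g : ModularForm 𝒮ℒ 0 :=
    { toFun := fun τ => discriminant τ / f τ
      slash_action_eq' := fun _ ⟨γ, hγ⟩ => hγ ▸ hslash γ
      holo' := CuspForm.discriminant.holo'.div f.holo' fun τ => (hf τ).symm ▸ hf0 τ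
      bdd_at_cusps' := fun {c} hc => by
        rw [Subgroup.IsArithmetic.isCusp_iff_isCusp_SL2Z] at hc
        rw [isBoundedAt_iff_forall_SL2Z hc]
        intro γ _
        rw [hslash γ, IsBoundedAtImInfty, BoundedAtFilter]
        exact hlim.isBigO_one ℝ }
  obtain ⟨c, hc⟩ := ModularFormClass.levelOne_weight_zero_const g
  have hg : ∀ τ : ℍ, discriminant τ / f τ = c := fun τ => congrFun hc τ
  simp_rw [hg] at hlim
  have hc0 : c = 0 := tendsto_nhds_unique tendsto_const_nhds hlim
  have := hg I
  rw [hc0, hf] at this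
  exact div_ne_zero (discriminant_ne_zero I) (hf0 I) this

/-! ### The `j`-invariant of a complex torus -/

open ModularForm EisensteinSeries in
theorem periodPair_G (τ : ℍ) {k : ℕ} (hk : 3 ≤ k) :
    (periodPair τ).G k = 2 * riemannZeta k * E hk τ := by
  have h1 : (periodPair τ).G k = ∑' v : Fin 2 → ℤ, eisSummand k v τ := by
    -- The periods are ordered (1, τ) while `eisSummand` uses v 0 · τ + v 1, so the coordinates are
    -- swapped.
    rw [PeriodPair.G, ← (periodPair τ).latticeEquivProd.symm.toEquiv.tsum_eq,
      ← (Equiv.prodComm ℤ ℤ).tsum_eq, ← (finTwoArrowEquiv ℤ).tsum_eq]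
    refine tsum_congr fun v => ?_
    have := (periodPair τ).latticeEquiv_symm_apply (v 1, v 0)
    change (((periodPair τ).latticeEquivProd.symm (v 1, v 0) : ℂ) ^ k)⁻¹ = _
    rw [this, eisSummand, zpow_neg, zpow_natCast]
    simp [periodPair, add_comm]
  rw [h1, tsum_eisSummand_eq_riemannZeta_mul_eisensteinSeries hk,
    show E hk τ = (1 / 2 : ℂ) • eisensteinSeriesSIF (N := 1) 0 k τ from rfl,
    eisensteinSeriesSIF_apply 0 k τ, smul_eq_mul]
  ring

theorem riemannZeta_six : riemannZeta 6 = (Real.pi : ℂ) ^ 6 / 945 := by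
  have h := riemannZeta_two_mul_nat (k := 3) (by norm_num)
  have hb : bernoulli 6 = 1 / 42 := by
    have h5 : bernoulli' 5 = 0 := bernoulli'_eq_zero_of_odd (by decide) (by norm_num)
    rw [bernoulli_eq_bernoulli'_of_ne_one (by norm_num), bernoulli'_def]
    norm_num [Finset.sum_range_succ, Nat.choose, h5]
  norm_num [hb, Nat.factorial] at h
  rw [h]; ring

open ModularForm in
theorem torusCurve_c₄ (τ : ℍ) : (torusCurve τ).c₄ = (2 * Real.pi) ^ 4 * E₄ τ := by
  have h4 := periodPair_G τ (k := 4) (by norm_num)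
  norm_num [riemannZeta_four] at h4
  simp only [torusCurve, WeierstrassCurve.c₄, WeierstrassCurve.b₂, WeierstrassCurve.b₄,
    PeriodPair.g₂, h4]
  ring

open ModularForm in
theorem torusCurve_Δ (τ : ℍ) : (torusCurve τ).Δ = (2 * Real.pi) ^ 12 * discriminant τ := by
  have h4 := periodPair_G τ (k := 4) (by norm_num)
  have h6 := periodPair_G τ (k := 6) (by norm_num)
  norm_num [riemannZeta_four] at h4
  norm_num [riemannZeta_six] at h6
  rw [discriminant_eq_E₄_cube_sub_E₆_sq]
  simp only [torusCurve, WeierstrassCurve.Δ, WeierstrassCurve.b₂, WeierstrassCurve.b₄,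
    WeierstrassCurve.b₆, WeierstrassCurve.b₈, PeriodPair.g₂, PeriodPair.g₃, h4, h6]
  ring

instance torusCurve_isElliptic (τ : ℍ) : (torusCurve τ).IsElliptic := by
  rw [WeierstrassCurve.isElliptic_iff, torusCurve_Δ, isUnit_iff_ne_zero]
  have : (Real.pi : ℂ) ≠ 0 := by exact_mod_cast Real.pi_ne_zero
  exact mul_ne_zero (pow_ne_zero _ (mul_ne_zero two_ne_zero this))
    (ModularForm.discriminant_ne_zero τ)

theorem j_eq_c₄_pow_div_Δ {F : Type*} [Field F] (E : WeierstrassCurve F) [E.IsElliptic] :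
    E.j = E.c₄ ^ 3 / E.Δ := by
  rw [WeierstrassCurve.j, Units.val_inv_eq_inv_val, WeierstrassCurve.coe_Δ']
  ring

theorem torusCurve_j (τ : ℍ) : (torusCurve τ).j = jInv τ := by
  rw [j_eq_c₄_pow_div_Δ, torusCurve_c₄, torusCurve_Δ, jInv]
  have := ModularForm.discriminant_ne_zero τ
  have : (Real.pi : ℂ) ≠ 0 := by exact_mod_cast Real.pi_ne_zero
  field_simp

theorem isUniformizedBy_iff (E : WeierstrassCurve ℂ) [E.IsElliptic] (τ : ℍ) :
    IsUniformizedBy E τ ↔ jInv τ = E.j := by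
  rw [← torusCurve_j]
  constructor
  · rintro ⟨C, hC⟩
    simp_rw [← hC]
    exact WeierstrassCurve.variableChange_j _ _
  · intro h
    exact E.exists_variableChange_of_j_eq _ h.symm

/-- A chosen preimage of a complex number under the `j`-invariant. -/
def jPreimage (ζ : ℂ) : ℍ := Classical.epsilon fun τ : ℍ => jInv τ = ζ

theorem jInv_jPreimage (ζ : ℂ) : jInv (jPreimage ζ) = ζ :=
  Classical.epsilon_spec (jInv_surjective ζ)

/-- The predicates given to `Classical.epsilon` are equal, so the two points coincide in ℍ and not
only modulo SL₂(ℤ); invariance of the Petersson norm is never needed. -/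
theorem periodPoint_eq (E : WeierstrassCurve ℂ) [E.IsElliptic] :
    periodPoint E = jPreimage E.j := by
  rw [periodPoint, jPreimage]
  simp_rw [isUniformizedBy_iff]

/-! ### Semistable reduction at a finite place -/

section Local

variable {K : Type*} [Field K] [NumberField K] (v : HeightOneSpectrum (𝓞 K))

/-- Reduction types refer to the valuation of the maximal ideal of `localRing v`, norms and
exponents to that of `v`; this passes from one to the other. -/
theorem localRing_valuation_isEquiv :
    ((IsDiscreteValuationRing.maximalIdeal (localRing v)).valuation K).IsEquiv
      (v.valuation K) := by
  refine Valuation.isEquiv_of_val_le_one fun {x} => ⟨fun h => ?_, fun h => ?_⟩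
  · obtain ⟨a, rfl⟩ := IsDiscreteValuationRing.exists_lift_of_le_one h
    exact a.2
  · exact HeightOneSpectrum.valuation_le_one _ (⟨x, h⟩ : localRing v)

theorem isIntegral_localRing {W : WeierstrassCurve K} (h₁ : v.valuation K W.a₁ ≤ 1)
    (h₂ : v.valuation K W.a₂ ≤ 1) (h₃ : v.valuation K W.a₃ ≤ 1) (h₄ : v.valuation K W.a₄ ≤ 1)
    (h₆ : v.valuation K W.a₆ ≤ 1) : W.IsIntegral (localRing v) :=
  WeierstrassCurve.isIntegral_of_exists_lift _ ⟨⟨_, h₁⟩, rfl⟩ ⟨⟨_, h₂⟩, rfl⟩ ⟨⟨_, h₃⟩, rfl⟩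
    ⟨⟨_, h₄⟩, rfl⟩ ⟨⟨_, h₆⟩, rfl⟩

theorem valuation_Δ_le_one (W : WeierstrassCurve K) [W.IsIntegral (localRing v)] :
    v.valuation K W.Δ ≤ 1 := by
  rw [← W.integralModel_Δ_eq (localRing v)]
  exact (W.integralModel (localRing v)).Δ.2

theorem valuation_c₄_le_one (W : WeierstrassCurve K) [W.IsIntegral (localRing v)] :
    v.valuation K W.c₄ ≤ 1 := by
  rw [← W.integralModel_c₄_eq (localRing v)]
  exact (W.integralModel (localRing v)).c₄.2

/-- A change of variables from a minimal equation to an integral one is integral in `u`. -/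
theorem valuation_u_inv_le_one {W : WeierstrassCurve K} [W.IsElliptic]
    [hW : W.IsMinimal (localRing v)] (C : WeierstrassCurve.VariableChange K)
    (hC : (C • W).IsIntegral (localRing v)) : v.valuation K (C.u⁻¹ : Kˣ) ≤ 1 := by
  -- Valuations are multiplicative: a maximal valuation of Δ means a minimal order of vanishing.
  have hmax : (C • W).valuation_Δ_aux (localRing v) ≤
      ((1 : WeierstrassCurve.VariableChange K) • W).valuation_Δ_aux (localRing v) := by
    rcases le_total (((1 : WeierstrassCurve.VariableChange K) • W).valuation_Δ_aux (localRing v))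
      ((C • W).valuation_Δ_aux (localRing v)) with h | h
    · exact hW.val_Δ_maximal.2 hC h
    · exact h
  rw [one_smul, ← Subtype.coe_le_coe, WeierstrassCurve.valuation_Δ_aux_eq_of_isIntegral,
    WeierstrassCurve.valuation_Δ_aux_eq_of_isIntegral, (localRing_valuation_isEquiv v).le_iff_le,
    WeierstrassCurve.variableChange_Δ, map_mul, map_pow] at hmax
  have hΔ : 0 < v.valuation K W.Δ := by
    rw [zero_lt_iff, Valuation.ne_zero_iff]; exact W.isUnit_Δ.ne_zero
  have h12 : v.valuation K (C.u⁻¹ : Kˣ) ^ 12 ≤ 1 := by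
    by_contra! h
    exact absurd hmax (not_le.mpr (by simpa using mul_lt_mul_of_pos_right h hΔ))
  exact (pow_le_one_iff (by norm_num)).mp h12

instance minimal_isElliptic (E : WeierstrassCurve K) [E.IsElliptic] :
    (E.minimal (localRing v)).IsElliptic := by
  unfold WeierstrassCurve.minimal; infer_instance

theorem exists_smul_minimal (E : WeierstrassCurve K) (C : WeierstrassCurve.VariableChange K) :
    ∃ D : WeierstrassCurve.VariableChange K, D • E.minimal (localRing v) = C • E := by
  refine ⟨C * (E.exists_isMinimal (localRing v)).choose⁻¹, ?_⟩
  rw [WeierstrassCurve.minimal, mul_smul, inv_smul_smul]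

/-- An elliptic curve that has an integral equation whose `c₄` or `Δ` is a unit has good or
multiplicative reduction. -/
theorem good_or_multiplicative_of_unit (E : WeierstrassCurve K) [E.IsElliptic]
    (C : WeierstrassCurve.VariableChange K) (hC : (C • E).IsIntegral (localRing v))
    (h : v.valuation K (C • E).c₄ = 1 ∨ v.valuation K (C • E).Δ = 1) :
    (E.minimal (localRing v)).HasGoodReduction (localRing v) ∨
      (E.minimal (localRing v)).HasMultiplicativeReduction (localRing v) := by
  obtain ⟨D, hD⟩ := exists_smul_minimal v E C
  rw [← hD] at hC h
  have hu := valuation_u_inv_le_one v D hC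
  have hc := valuation_c₄_le_one v (E.minimal (localRing v))
  have hΔ := valuation_Δ_le_one v (E.minimal (localRing v))
  -- Applied to x = |u⁻¹| and y = |c₄| or |Δ| of the minimal equation: a unit that is a product of
  -- integral factors has unit factors.
  have key : ∀ {n : ℕ} {x y : WithZero (Multiplicative ℤ)}, x ≤ 1 → y ≤ 1 → x ^ n * y = 1 →
      y = 1 := fun hx hy hxy => le_antisymm hy (hxy ▸ mul_le_of_le_one_left' (pow_le_one' hx _))
  rw [WeierstrassCurve.variableChange_c₄, WeierstrassCurve.variableChange_Δ, map_mul, map_mul,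
    map_pow, map_pow] at h
  have he := localRing_valuation_isEquiv v
  rw [WeierstrassCurve.hasGoodReduction_iff, WeierstrassCurve.hasMultiplicativeReduction_iff,
    he.eq_one_iff_eq_one, he.eq_one_iff_eq_one, he.lt_one_iff_lt_one]
  rcases eq_or_lt_of_le hΔ with h1 | h1
  · exact Or.inl ⟨inferInstance, h1⟩
  · rcases h with h | h
    · exact Or.inr ⟨inferInstance, h1, key hu hc h⟩
    · exact absurd (key hu hΔ h) h1.ne

/-- At a place of good or multiplicative reduction the minimal discriminant is the denominator of
the `j`-invariant. -/
theorem max_one_valuation_j (E : WeierstrassCurve K) [E.IsElliptic]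
    (h : (E.minimal (localRing v)).HasGoodReduction (localRing v) ∨
      (E.minimal (localRing v)).HasMultiplicativeReduction (localRing v)) :
    max 1 (v.valuation K E.j) = (v.valuation K (E.minimal (localRing v)).Δ)⁻¹ := by
  have hj : E.j = (E.minimal (localRing v)).j := by
    unfold WeierstrassCurve.minimal; rw [WeierstrassCurve.variableChange_j]
  have hc := valuation_c₄_le_one v (E.minimal (localRing v))
  have hΔ := valuation_Δ_le_one v (E.minimal (localRing v))
  have hΔ0 : 0 < v.valuation K (E.minimal (localRing v)).Δ := by
    rw [zero_lt_iff, Valuation.ne_zero_iff]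
    exact (E.minimal (localRing v)).isUnit_Δ.ne_zero
  have he := localRing_valuation_isEquiv v
  rw [WeierstrassCurve.hasGoodReduction_iff, WeierstrassCurve.hasMultiplicativeReduction_iff,
    he.eq_one_iff_eq_one, he.eq_one_iff_eq_one, he.lt_one_iff_lt_one] at h
  rw [hj, j_eq_c₄_pow_div_Δ, map_div₀, map_pow]
  rcases h with ⟨-, h⟩ | ⟨-, -, h⟩
  · rw [h, div_one, inv_one]
    exact max_eq_left (pow_le_one' hc 3)
  · rw [h, one_pow, one_div]
    exact max_eq_right ((one_le_inv₀ hΔ0).mpr hΔ)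

theorem absNorm_pow_minDiscExponent (E : WeierstrassCurve K) [E.IsElliptic]
    (h : (E.minimal (localRing v)).HasGoodReduction (localRing v) ∨
      (E.minimal (localRing v)).HasMultiplicativeReduction (localRing v)) :
    (Ideal.absNorm v.asIdeal : ℝ) ^ minDiscExponent E v = max (FinitePlace.mk v E.j) 1 := by
  have hm := max_one_valuation_j v E h
  have hΔ := valuation_Δ_le_one v (E.minimal (localRing v))
  have hΔ0 : v.valuation K (E.minimal (localRing v)).Δ ≠ 0 := by
    rw [Valuation.ne_zero_iff]
    exact (E.minimal (localRing v)).isUnit_Δ.ne_zero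
  have hmono := WithZeroMulInt.toNNReal_strictMono
    (NumberField.HeightOneSpectrum.one_lt_absNorm_nnreal v)
  have h2 : max (FinitePlace.mk v E.j) 1 = WithZeroMulInt.toNNReal
      (NumberField.HeightOneSpectrum.absNorm_ne_zero v)
        (v.valuation K (E.minimal (localRing v)).Δ)⁻¹ := by
    rw [← hm, hmono.monotone.map_max, map_one, FinitePlace.mk_apply, FinitePlace.norm_embedding',
      max_comm]
    simp
  rw [h2, minDiscExponent]
  generalize v.valuation K (E.minimal (localRing v)).Δ = δ at hΔ hΔ0
  obtain ⟨n, rfl⟩ : ∃ n : ℤ, δ = WithZero.exp n := ⟨WithZero.log δ, (WithZero.exp_log hΔ0).symm⟩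
  have hn : n ≤ 0 := by simpa [← WithZero.exp_zero] using hΔ
  -- Integrality of the minimal discriminant ensures that `toNat` in `minDiscExponent` truncates
  -- nothing.
  obtain ⟨k, rfl⟩ : ∃ k : ℕ, n = -k := ⟨n.natAbs, by omega⟩
  rw [WithZero.log_exp, neg_neg, Int.toNat_natCast, map_inv₀,
    WithZeroMulInt.toNNReal_neg_apply _ WithZero.exp_ne_zero, WithZero.toAdd_unzero_eq_log,
    WithZero.log_exp, zpow_neg, inv_inv, zpow_natCast]
  simp

/-! ### Two families of equations with semistable reduction -/

/-- The Deuring normal form `Y² + a XY + Y = X³`. -/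
def deuringCurve {F : Type*} [Field F] (a : F) : WeierstrassCurve F := ⟨a, 0, 1, 0, 0⟩

/-- The Legendre normal form `Y² = X (X - 1) (X - m²)`. -/
def legendreCurve {F : Type*} [Field F] (m : F) : WeierstrassCurve F :=
  ⟨0, -(1 + m ^ 2), 0, m ^ 2, 0⟩

theorem deuringCurve_Δ {F : Type*} [Field F] (a : F) : (deuringCurve a).Δ = a ^ 3 - 27 := by
  simp only [deuringCurve, WeierstrassCurve.Δ, WeierstrassCurve.b₂, WeierstrassCurve.b₄,
    WeierstrassCurve.b₆, WeierstrassCurve.b₈]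
  ring

theorem deuringCurve_c₄ {F : Type*} [Field F] (a : F) :
    (deuringCurve a).c₄ = a * (a ^ 3 - 24) := by
  simp only [deuringCurve, WeierstrassCurve.c₄, WeierstrassCurve.b₂, WeierstrassCurve.b₄]
  ring

theorem legendreCurve_Δ {F : Type*} [Field F] (m : F) :
    (legendreCurve m).Δ = 16 * (m ^ 2 * (m ^ 2 - 1)) ^ 2 := by
  simp only [legendreCurve, WeierstrassCurve.Δ, WeierstrassCurve.b₂, WeierstrassCurve.b₄,
    WeierstrassCurve.b₆, WeierstrassCurve.b₈]
  ring

theorem legendreCurve_c₄ {F : Type*} [Field F] (m : F) :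
    (legendreCurve m).c₄ = 16 * (m ^ 2 * (m ^ 2 - 1) + 1) := by
  simp only [legendreCurve, WeierstrassCurve.c₄, WeierstrassCurve.b₂, WeierstrassCurve.b₄]
  ring

theorem valuation_natCast_le_one (n : ℕ) : v.valuation K (n : K) ≤ 1 := by
  simpa using v.valuation_le_one (K := K) (n : 𝓞 K)

/-- For integral a, if Δ = a³ - 27 is not a unit then a³ ≡ 27 and a³ - 24 ≡ 3 are units, hence so is
c₄ = a(a³ - 24). For non-integral a, rescaling by u = a gives c₄ = 1 - 24a⁻³. -/
theorem deuringCurve_unit_model (a : K) (h3 : v.valuation K 3 = 1) :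
    ∃ C : WeierstrassCurve.VariableChange K, (C • deuringCurve a).IsIntegral (localRing v) ∧
      (v.valuation K (C • deuringCurve a).c₄ = 1 ∨ v.valuation K (C • deuringCurve a).Δ = 1) := by
  rcases le_or_gt (v.valuation K a) 1 with ha | ha
  · refine ⟨1, ?_, ?_⟩
    · rw [one_smul]
      apply isIntegral_localRing <;> simp [deuringCurve, ha]
    · rw [one_smul, deuringCurve_c₄, deuringCurve_Δ]
      rcases lt_or_ge (v.valuation K (a ^ 3 - 27)) 1 with h | h
      · left
        have h27 : v.valuation K (a ^ 3) = 1 := by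
          rw [show a ^ 3 = (a ^ 3 - 27) + 3 ^ 3 by ring,
            Valuation.map_add_eq_of_lt_right] <;> simp [h3, h]
        have h24 : v.valuation K (a ^ 3 - 24) = 1 := by
          rw [show a ^ 3 - 24 = (a ^ 3 - 27) + 3 by ring,
            Valuation.map_add_eq_of_lt_right] <;> simp [h3, h]
        have h1 : v.valuation K a = 1 := by
          rw [map_pow] at h27
          by_contra hne
          exact (pow_lt_one' (lt_of_le_of_ne ha hne) (by norm_num)).ne h27
        rw [map_mul, h1, h24, one_mul]
      · right
        refine le_antisymm ?_ h
        refine ((v.valuation K).map_sub _ _).trans (max_le ?_ ?_)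
        · rw [map_pow]; exact pow_le_one' ha 3
        · exact_mod_cast valuation_natCast_le_one v 27
  · have ha0 : a ≠ 0 := by rintro rfl; simp at ha
    have hinv : v.valuation K a⁻¹ < 1 := by rw [map_inv₀]; exact inv_lt_one_of_one_lt₀ ha
    have hu : ((Units.mk0 a ha0)⁻¹ : Kˣ) = (a⁻¹ : K) := by simp
    refine ⟨⟨Units.mk0 a ha0, 0, 0, 0⟩, ?_, Or.inl ?_⟩
    · apply isIntegral_localRing <;>
        simp [deuringCurve, WeierstrassCurve.variableChange_def, ha0]
      exact inv_le_one_of_one_le₀ (one_le_pow₀ ha.le)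
    · rw [WeierstrassCurve.variableChange_c₄, deuringCurve_c₄, hu,
        show a⁻¹ ^ 4 * (a * (a ^ 3 - 24)) = 1 - 24 * a⁻¹ ^ 3 by field_simp,
        Valuation.map_one_sub_of_lt]
      rw [map_mul, map_pow]
      refine mul_lt_one_of_nonneg_of_lt_one_right ?_ zero_le (pow_lt_one' hinv (by norm_num))
      exact_mod_cast valuation_natCast_le_one v 24

/-- With t = m²(m² - 1), Δ = 16t² and c₄ = 16(t + 1), so for integral m one of them is a unit. For
non-integral m the rescaling by u = m works; the Legendre parameter is taken to be a square so that
this u lies in K. -/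
theorem legendreCurve_unit_model (m : K) (h2 : v.valuation K 2 = 1) :
    ∃ C : WeierstrassCurve.VariableChange K, (C • legendreCurve m).IsIntegral (localRing v) ∧
      (v.valuation K (C • legendreCurve m).c₄ = 1 ∨
        v.valuation K (C • legendreCurve m).Δ = 1) := by
  have h16 : v.valuation K 16 = 1 := by
    rw [show (16 : K) = 2 ^ 4 by norm_num, map_pow, h2, one_pow]
  rcases le_or_gt (v.valuation K m) 1 with hm | hm
  · have hm2 : v.valuation K (m ^ 2) ≤ 1 := by rw [map_pow]; exact pow_le_one' hm 2
    refine ⟨1, ?_, ?_⟩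
    · rw [one_smul]
      apply isIntegral_localRing <;> simp only [legendreCurve, map_zero, zero_le, hm2]
      rw [Valuation.map_neg]
      exact ((v.valuation K).map_add _ _).trans (max_le (by simp) hm2)
    · rw [one_smul, legendreCurve_c₄, legendreCurve_Δ]
      have ht : v.valuation K (m ^ 2 * (m ^ 2 - 1)) ≤ 1 := by
        rw [map_mul]
        exact mul_le_one' hm2 (((v.valuation K).map_sub _ _).trans (max_le hm2 (by simp)))
      rcases eq_or_lt_of_le ht with h | h
      · right; rw [map_mul, map_pow, h, h16]; simp
      · left; rw [map_mul, add_comm, Valuation.map_one_add_of_lt _ h, h16, one_mul]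
  · have hm0 : m ≠ 0 := by rintro rfl; simp at hm
    have hinv : v.valuation K m⁻¹ < 1 := by rw [map_inv₀]; exact inv_lt_one_of_one_lt₀ hm
    have hinv2 : v.valuation K (m⁻¹ ^ 2) < 1 := by
      rw [map_pow]; exact pow_lt_one' hinv (by norm_num)
    have hu : ((Units.mk0 m hm0)⁻¹ : Kˣ) = (m⁻¹ : K) := by simp
    refine ⟨⟨Units.mk0 m hm0, 0, 0, 0⟩, ?_, Or.inl ?_⟩
    · apply isIntegral_localRing <;>
        simp only [legendreCurve, WeierstrassCurve.variableChange_def, hu]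
      · simp
      · rw [show m⁻¹ ^ 2 * (-(1 + m ^ 2) - 0 * 0 + 3 * 0 - 0 ^ 2) = -(1 + m⁻¹ ^ 2) by
          field_simp; ring, Valuation.map_neg, Valuation.map_one_add_of_lt _ hinv2]
      · simp
      · rw [show m⁻¹ ^ 4 * (m ^ 2 - 0 * 0 + 2 * 0 * -(1 + m ^ 2) - (0 + 0 * 0) * 0 + 3 * 0 ^ 2
          - 2 * 0 * 0) = m⁻¹ ^ 2 by field_simp; ring]
        exact hinv2.le
      · simp
    · rw [WeierstrassCurve.variableChange_c₄, legendreCurve_c₄, hu,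
        show m⁻¹ ^ 4 * (16 * (m ^ 2 * (m ^ 2 - 1) + 1)) =
          16 * (1 + (m⁻¹ ^ 2 * (m⁻¹ ^ 2 - 1))) by field_simp; ring, map_mul, h16, one_mul,
        Valuation.map_one_add_of_lt]
      rw [map_mul]
      refine mul_lt_one_of_lt_of_le hinv2 ?_
      exact ((v.valuation K).map_sub _ _).trans (max_le hinv2.le (by simp))

end Local

/-- A curve in Deuring normal form that is also given by a Legendre normal form is semistable. -/
theorem isSemistable_deuringCurve {K : Type*} [Field K] [NumberField K] (a m : K)
    (C : WeierstrassCurve.VariableChange K) (hC : C • deuringCurve a = legendreCurve m)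
    [(deuringCurve a).IsElliptic] : IsSemistable (deuringCurve a) := by
  intro v
  have h3 := valuation_natCast_le_one v 3
  have h2 := valuation_natCast_le_one v 2
  push_cast at h2 h3
  rcases eq_or_lt_of_le h3 with h3 | h3
  · obtain ⟨D, hD, hu⟩ := deuringCurve_unit_model v a h3
    exact good_or_multiplicative_of_unit v _ D hD hu
  · rcases eq_or_lt_of_le h2 with h2 | h2
    · obtain ⟨D, hD, hu⟩ := legendreCurve_unit_model v m h2
      rw [← hC, ← mul_smul] at hD hu
      exact good_or_multiplicative_of_unit v _ _ hD hu
    · have := (v.valuation K).map_sub_lt h3 h2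
      norm_num at this

open Polynomial in
/-- Every algebraic number is the `j`-invariant of a semistable elliptic curve. -/
theorem exists_semistable (α : Qbar) :
    ∃ (L : IntermediateField ℚ Qbar) (_ : NumberField L) (E : WeierstrassCurve L)
      (_ : E.IsElliptic), IsSemistable E ∧ ((E.j : L) : Qbar) = α := by
  -- This is j = α for the Deuring form: a quartic in t = a³.
  obtain ⟨a, ha⟩ : ∃ a : Qbar, a ^ 3 * (a ^ 3 - 24) ^ 3 = α * (a ^ 3 - 27) := by
    have hdeg : (X * (X - C 24) ^ 3 - C α * (X - C 27) : Qbar[X]).natDegree = 4 := by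
      compute_degree!
    obtain ⟨t, ht⟩ := IsAlgClosed.exists_root
      (X * (X - C 24) ^ 3 - C α * (X - C 27) : Qbar[X])
      (degree_ne_of_natDegree_ne (by rw [hdeg]; exact four_ne_zero))
    obtain ⟨a, rfl⟩ := IsAlgClosed.exists_pow_nat_eq t (n := 3) (by norm_num)
    exact ⟨a, by simpa [IsRoot.def, sub_eq_zero] using ht⟩
  -- This is j = α for the Legendre form: a cubic in t = l(l - 1), where l = m².
  obtain ⟨m, hm⟩ : ∃ m : Qbar, 256 * (m ^ 2 * (m ^ 2 - 1) + 1) ^ 3 =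
      α * (m ^ 2 * (m ^ 2 - 1)) ^ 2 := by
    have hdeg : (C 256 * (X + C 1) ^ 3 - C α * X ^ 2 : Qbar[X]).natDegree = 3 := by
      compute_degree!
    obtain ⟨t, ht⟩ := IsAlgClosed.exists_root
      (C 256 * (X + C 1) ^ 3 - C α * X ^ 2 : Qbar[X])
      (degree_ne_of_natDegree_ne (by rw [hdeg]; exact three_ne_zero))
    have hdeg' : (X * (X - C 1) - C t : Qbar[X]).natDegree = 2 := by
      compute_degree!
    obtain ⟨l, hl⟩ := IsAlgClosed.exists_root
      (X * (X - C 1) - C t : Qbar[X]) (degree_ne_of_natDegree_ne (by rw [hdeg']; exact two_ne_zero))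
    obtain ⟨m, rfl⟩ := IsAlgClosed.exists_pow_nat_eq l (n := 2) (by norm_num)
    have hl' : m ^ 2 * (m ^ 2 - 1) = t := by
      simpa [IsRoot.def, sub_eq_zero] using hl
    exact ⟨m, by rw [hl']; simpa [IsRoot.def, sub_eq_zero] using ht⟩
  have hΔa : a ^ 3 - 27 ≠ 0 := by
    intro h
    have h27 : a ^ 3 = 27 := sub_eq_zero.mp h
    rw [h, h27] at ha
    norm_num at ha
  have hΔm : m ^ 2 * (m ^ 2 - 1) ≠ 0 := by
    intro h
    rw [h] at hm
    norm_num at hm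
  have e1 : (deuringCurve a).IsElliptic := by
    rw [WeierstrassCurve.isElliptic_iff, deuringCurve_Δ]
    exact hΔa.isUnit
  have e2 : (legendreCurve m).IsElliptic := by
    rw [WeierstrassCurve.isElliptic_iff, legendreCurve_Δ]
    exact (mul_ne_zero (by norm_num) (pow_ne_zero _ hΔm)).isUnit
  have j1 : (deuringCurve a).j = α := by
    rw [j_eq_c₄_pow_div_Δ, deuringCurve_c₄, deuringCurve_Δ, div_eq_iff hΔa, mul_pow, ha]
  have j2 : (legendreCurve m).j = α := by
    rw [j_eq_c₄_pow_div_Δ, legendreCurve_c₄, legendreCurve_Δ,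
      div_eq_iff (mul_ne_zero (by norm_num) (pow_ne_zero _ hΔm))]
    linear_combination 16 * hm
  obtain ⟨C, hC⟩ := WeierstrassCurve.exists_variableChange_of_j_eq (deuringCurve a)
    (legendreCurve m) (j1.trans j2.symm)
  -- The coefficients of the isomorphism are adjoined as well, since over ℚ(a, m) the two curves
  -- might only be twists of each other.
  let S : Set Qbar := {a, m, (C.u : Qbar), C.r, C.s, C.t}
  let L : IntermediateField ℚ Qbar := IntermediateField.adjoin ℚ S
  have hS : ∀ x ∈ S, x ∈ L := fun x hx => IntermediateField.subset_adjoin ℚ S hx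
  have hfin : FiniteDimensional ℚ L := by
    have : Finite S := Set.toFinite S
    exact IntermediateField.finiteDimensional_adjoin fun x _ => Algebra.IsIntegral.isIntegral x
  have hL : NumberField L := { to_charZero := inferInstance, to_finiteDimensional := hfin }
  let a' : L := ⟨a, hS a (by simp [S])⟩
  let m' : L := ⟨m, hS m (by simp [S])⟩
  let u' : Lˣ := Units.mk0 ⟨C.u, hS _ (by simp [S])⟩ (by
    intro h; exact C.u.ne_zero (congrArg Subtype.val h))
  let C' : WeierstrassCurve.VariableChange L :=
    ⟨u', ⟨C.r, hS _ (by simp [S])⟩, ⟨C.s, hS _ (by simp [S])⟩, ⟨C.t, hS _ (by simp [S])⟩⟩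
  let φ : L →+* Qbar := L.val
  have hC' : C'.map φ = C := by
    ext <;> rfl
  have hE : (deuringCurve a').map φ = deuringCurve a := by
    simp [deuringCurve, WeierstrassCurve.map, φ, a']
  have hE2 : (legendreCurve m').map φ = legendreCurve m := by
    simp [legendreCurve, WeierstrassCurve.map, φ, m']
  have hiso : C' • deuringCurve a' = legendreCurve m' := by
    apply WeierstrassCurve.map_injective φ.injective
    change (C' • deuringCurve a').map φ = (legendreCurve m').map φ
    rw [← WeierstrassCurve.map_variableChange, hC', hE, hC, hE2]
  have e1' : (deuringCurve a').IsElliptic := by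
    rw [WeierstrassCurve.isElliptic_iff, isUnit_iff_ne_zero]
    intro h
    apply hΔa
    rw [← deuringCurve_Δ, ← hE, WeierstrassCurve.map_Δ, h, map_zero]
  refine ⟨L, hL, deuringCurve a', e1', isSemistable_deuringCurve a' m' C' hiso, ?_⟩
  have hj := (deuringCurve a').map_j φ
  simp_rw [hE] at hj
  exact hj.symm.trans j1

/-! ### The finite part of the height -/

section FinitePart

variable {K : Type*} [Field K] [NumberField K]

theorem hasFiniteMulSupport_max_one (ζ : K) :
    (fun v : FinitePlace K => max (v ζ) 1).HasFiniteMulSupport := by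
  rcases eq_or_ne ζ 0 with rfl | hζ
  · simp [Function.HasFiniteMulSupport, Function.mulSupport]
  · refine (FinitePlace.hasFiniteMulSupport hζ).subset fun v hv h => hv ?_
    simp [show v ζ = 1 from h]

/-- For `ζ = a / b` the product of the `max(|ζ|_v, 1)` over the finite places is the quotient of
the norms of the ideals `(b)` and `(a, b)`. -/
theorem finprod_max_one_mul_absNorm (a : 𝓞 K) {b : 𝓞 K} (hb : b ≠ 0) :
    (∏ᶠ v : FinitePlace K, max (v ((a : K) / b)) 1) * Ideal.absNorm (Ideal.span {a, b}) =
      Ideal.absNorm (Ideal.span {b}) := by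
  have hx : ![a, b] ≠ 0 := fun h => hb (congrFun h 1)
  have h1 := NumberField.absNorm_mul_finprod_finitePlace_eq_one hx
  have h2 := NumberField.absNorm_mul_finprod_finitePlace_eq_one
    (x := fun _ : Unit => b) (fun h => hb (congrFun h ()))
  have hb' : (b : K) ≠ 0 := by simpa using hb
  have h3 : ∏ᶠ v : FinitePlace K, ⨆ i, v (![a, b] i) =
      (∏ᶠ v : FinitePlace K, max (v ((a : K) / b)) 1) * ∏ᶠ v : FinitePlace K, v b := by
    rw [← finprod_mul_distrib (hasFiniteMulSupport_max_one _) (FinitePlace.hasFiniteMulSupport hb')]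
    refine finprod_congr fun v => ?_
    have hvb : 0 < v (b : K) := FinitePlace.pos_iff.mpr hb'
    rw [map_div₀, max_mul_of_nonneg _ _ hvb.le, div_mul_cancel₀ _ hvb.ne', one_mul]
    exact eq_of_forall_ge_iff fun c => by
      rw [ciSup_le_iff (Set.finite_range _).bddAbove, Fin.forall_fin_two, max_le_iff]
      rfl
  simp only [ciSup_const, Set.range_const] at h2
  rw [h3, Matrix.range_cons, Matrix.range_cons, Matrix.range_empty, Set.union_empty,
    Set.singleton_union] at h1
  have h4 : ∏ᶠ v : FinitePlace K, v (b : K) ≠ 0 := right_ne_zero_of_mul_eq_one h2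
  apply mul_right_cancel₀ h4
  rw [h2]
  linear_combination h1

variable {L : Type*} [Field L] [NumberField L] [Algebra K L]

/-- Instead of splitting places in L, this expresses both products by norms of (b) and (a, b);
extending an ideal to L raises its norm to the power [L : K]. -/
theorem finprod_max_one_algebraMap (ζ : K) :
    ∏ᶠ w : FinitePlace L, max (w (algebraMap K L ζ)) 1 =
      (∏ᶠ v : FinitePlace K, max (v ζ) 1) ^ Module.finrank K L := by
  obtain ⟨a, b, hb, rfl⟩ := IsFractionRing.div_surjective (𝓞 K) ζ
  have hb0 : b ≠ 0 := nonZeroDivisors.ne_zero hb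
  have hbL : algebraMap (𝓞 K) (𝓞 L) b ≠ 0 := by simpa using hb0
  have hK := finprod_max_one_mul_absNorm a hb0
  have hL := finprod_max_one_mul_absNorm (algebraMap (𝓞 K) (𝓞 L) a) hbL
  have hr : Module.finrank (𝓞 K) (𝓞 L) = Module.finrank K L :=
    (IsFractionRing.finrank_eq (𝓞 K) K (𝓞 L) L).symm
  have hm : ∀ s : Set (𝓞 K), Ideal.absNorm (Ideal.span (algebraMap (𝓞 K) (𝓞 L) '' s)) =
      Ideal.absNorm (Ideal.span s) ^ Module.finrank K L := by
    intro s
    rw [← Ideal.map_span, Ideal.absNorm_algebraMap, hr]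
  have hm1 := hm {b}
  have hm2 := hm {a, b}
  rw [Set.image_singleton] at hm1
  rw [Set.image_pair] at hm2
  rw [hm1, hm2, Nat.cast_pow, Nat.cast_pow, ← hK, mul_pow] at hL
  have hne : ((Ideal.absNorm (Ideal.span {a, b}) : ℝ) ^ Module.finrank K L) ≠ 0 := by
    refine pow_ne_zero _ fun h => ?_
    rw [h, mul_zero] at hK
    exact hb0 (by simpa using hK.symm)
  have := mul_right_cancel₀ hne hL
  rw [← this]
  refine finprod_congr fun w => ?_
  rw [map_div₀]
  rfl

theorem finsum_log_max_one_algebraMap (ζ : K) :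
    ∑ᶠ w : FinitePlace L, Real.log (max (w (algebraMap K L ζ)) 1) =
      Module.finrank K L * ∑ᶠ v : FinitePlace K, Real.log (max (v ζ) 1) := by
  rw [← Real.log_finprod fun _ => by positivity, ← Real.log_finprod fun _ => by positivity,
    finprod_max_one_algebraMap ζ, Real.log_pow]

open scoped Classical in
/-- Every complex embedding of `K` has `[L : K]` extensions to `L`. -/
theorem card_embeddings_extending (τ : K →+* ℂ) :
    (Finset.univ.filter fun σ : L →+* ℂ => σ.comp (algebraMap K L) = τ).card =
      Module.finrank K L := by
  let _ : Algebra K ℂ := τ.toAlgebra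
  rw [← AlgHom.card K L ℂ, ← Fintype.card_subtype]
  refine Fintype.card_congr
    { toFun := fun σ => { σ.1 with commutes' := fun x => RingHom.congr_fun σ.2 x }
      invFun := fun σ => ⟨σ.toRingHom, RingHom.ext fun x => σ.commutes x⟩
      left_inv := fun σ => rfl
      right_inv := fun σ => rfl }

theorem sum_embeddings_algebraMap (f : ℂ → ℝ) (ζ : K) :
    ∑ σ : L →+* ℂ, f (σ (algebraMap K L ζ)) =
      Module.finrank K L * ∑ τ : K →+* ℂ, f (τ ζ) := by
  classical
  rw [← Finset.sum_fiberwise Finset.univ (fun σ : L →+* ℂ => σ.comp (algebraMap K L)),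
    Finset.mul_sum]
  refine Finset.sum_congr rfl fun τ _ => ?_
  rw [Finset.sum_congr rfl (g := fun _ => f (τ ζ)) ?_, Finset.sum_const, card_embeddings_extending,
    nsmul_eq_mul]
  intro σ hσ
  rw [← (Finset.mem_filter.mp hσ).2]
  rfl

/-- The product formula, in additive form. -/
theorem sum_log_finitePlace_add_sum_log_embeddings {x : K} (hx : x ≠ 0) :
    ∑ᶠ v : FinitePlace K, Real.log (v x) + ∑ σ : K →+* ℂ, Real.log ‖σ x‖ = 0 := by
  have hnorm : ∏ σ : K →+* ℂ, ‖σ x‖ = |(Algebra.norm ℚ x : ℝ)| := by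
    have h := congr_arg (‖·‖) (Algebra.norm_eq_prod_embeddings ℚ ℂ x)
    rw [norm_prod, ← Fintype.prod_equiv (RingHom.equivRatAlgHom K ℂ) (fun f => ‖f x‖)
      (fun φ => ‖φ x‖) fun _ => by simp [RingHom.equivRatAlgHom_apply]] at h
    rw [← h, eq_ratCast, ← Real.norm_eq_abs, ← Complex.norm_real, Complex.ofReal_ratCast]
  rw [← Real.log_finprod fun v => FinitePlace.pos_iff.mpr hx, FinitePlace.prod_eq_inv_abs_norm hx,
    ← Real.log_prod fun σ _ => by simpa using hx, hnorm]
  simp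

theorem log_absNorm_minimalDiscriminant (E : WeierstrassCurve K) [E.IsElliptic]
    (hE : IsSemistable E) :
    Real.log (Ideal.absNorm (minimalDiscriminant E) : ℝ) =
      ∑ᶠ v : FinitePlace K, Real.log (max (v E.j) 1) := by
  rw [← Real.log_finprod fun _ => by positivity]
  congr 1
  have h : (Ideal.absNorm (minimalDiscriminant E) : ℝ) =
      ∏ᶠ v : HeightOneSpectrum (𝓞 K), (Ideal.absNorm v.asIdeal : ℝ) ^ minDiscExponent E v := by
    rw [minimalDiscriminant]
    -- Only the unit ideal has norm 1, so the norm commutes with `∏ᶠ` without a finiteness check.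
    have := ((Nat.castRingHom ℝ).toMonoidHom.comp
      Ideal.absNorm.toMonoidHom).map_finprod_of_preimage_one (by simp)
        fun v : HeightOneSpectrum (𝓞 K) => v.asIdeal ^ minDiscExponent E v
    simpa using this
  rw [h, ← finprod_comp_equiv FinitePlace.equivHeightOneSpectrum.symm]
  exact finprod_congr fun v => absNorm_pow_minDiscExponent v E (hE v)

end FinitePart

/-! ### Evaluation of homogeneous forms -/

namespace IntegralSection

theorem aeval_form {A : Type*} [CommRing A] [Algebra ℤ A] (s : IntegralSection) (f : Fin 2 → A) :
    MvPolynomial.aeval f s.form =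
      ∑ d ∈ s.form.support, ((s.form.coeff d : ℤ) : A) * (f 0 ^ d 0 * f 1 ^ d 1) := by
  rw [MvPolynomial.aeval_def, MvPolynomial.eval₂_eq']
  simp [Fin.prod_univ_two]

theorem map_aeval_form {A B : Type*} [CommRing A] [CommRing B] [Algebra ℤ A] [Algebra ℤ B]
    (s : IntegralSection) (φ : A →+* B) (x : A) :
    φ (MvPolynomial.aeval ![x, 1] s.form) = MvPolynomial.aeval ![φ x, 1] s.form := by
  rw [aeval_form, aeval_form, map_sum]
  simp

theorem degree_eq (s : IntegralSection) {d : Fin 2 →₀ ℕ} (hd : d ∈ s.form.support) :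
    d 0 + d 1 = s.deg := by
  have h := s.isHomogeneous (MvPolynomial.mem_support_iff.mp hd)
  simpa [Finsupp.weight_apply, Finsupp.sum_fintype, Fin.sum_univ_two] using h

theorem aeval_form_mul {A : Type*} [CommRing A] [Algebra ℤ A] (s : IntegralSection) (c x y : A) :
    MvPolynomial.aeval ![c * x, c * y] s.form =
      c ^ s.deg * MvPolynomial.aeval ![x, y] s.form := by
  rw [aeval_form, aeval_form, Finset.mul_sum]
  refine Finset.sum_congr rfl fun d hd => ?_
  rw [← s.degree_eq hd]
  simp only [Matrix.cons_val_zero, Matrix.cons_val_one]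
  ring

/-- By homogeneity distinct monomials have distinct exponents of the first coordinate, so none
cancel on setting the second to 1 and the resulting polynomial is nonzero. -/
theorem finite_zeros (s : IntegralSection) :
    {x : Qbar | (x : OnePoint Qbar) ∈ s.support}.Finite := by
  let q : Polynomial ℤ := MvPolynomial.aeval ![Polynomial.X, 1] s.form
  obtain ⟨d, hd⟩ := MvPolynomial.support_nonempty.mpr s.ne_zero
  have hq : q.coeff (d 0) = s.form.coeff d := by
    simp only [q]
    rw [aeval_form, Polynomial.finsetSum_coeff, Finset.sum_eq_single_of_mem d hd]
    · simp
    · intro e he hne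
      have hne0 : d 0 ≠ e 0 := by
        intro h0
        have h1 := s.degree_eq hd
        have h2 := s.degree_eq he
        refine hne (Finsupp.ext fun i => ?_)
        fin_cases i
        · exact h0.symm
        · change e 1 = d 1
          omega
      simp [Polynomial.coeff_X_pow, hne0]
  have hq0 : q ≠ 0 := by
    intro h
    rw [h, Polynomial.coeff_zero] at hq
    exact MvPolynomial.mem_support_iff.mp hd hq.symm
  refine (q.rootSet_finite Qbar).subset fun x hx => ?_
  rw [Polynomial.mem_rootSet]
  refine ⟨hq0, ?_⟩
  have h : MvPolynomial.aeval ![x, 1] s.form = 0 := hx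
  rw [← h]
  refine (s.map_aeval_form (Polynomial.aeval (R := ℤ) x).toRingHom Polynomial.X).trans ?_
  rw [show (Polynomial.aeval (R := ℤ) x).toRingHom Polynomial.X = x from Polynomial.aeval_X x]

/-- The ultrametric inequality, with coefficients of absolute value at most 1. -/
theorem finitePlace_form_le {K : Type*} [Field K] [NumberField K] (s : IntegralSection)
    (v : FinitePlace K) (ζ : K) :
    v (MvPolynomial.aeval ![ζ, 1] s.form) ≤ max (v ζ) 1 ^ s.deg := by
  have hsum : ∀ (t : Finset (Fin 2 →₀ ℕ)) (f : (Fin 2 →₀ ℕ) → K),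
      (∀ d ∈ t, v (f d) ≤ max (v ζ) 1 ^ s.deg) → v (∑ d ∈ t, f d) ≤ max (v ζ) 1 ^ s.deg := by
    intro t f
    induction t using Finset.cons_induction with
    | empty => intro _; rw [Finset.sum_empty, map_zero]; positivity
    | cons d t hd ih =>
      intro h
      rw [Finset.sum_cons]
      exact (v.add_le _ _).trans (max_le (h d (Finset.mem_cons_self d t))
        (ih fun e he => h e (Finset.mem_cons_of_mem he)))
  rw [aeval_form]
  refine hsum _ _ fun d hd => ?_
  have hc : v ((s.form.coeff d : ℤ) : K) ≤ 1 := by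
    have := FinitePlace.norm_le_one K v.maximalIdeal ((s.form.coeff d : ℤ) : 𝓞 K)
    rw [FinitePlace.norm_embedding_eq] at this
    simpa using this
  rw [map_mul, map_mul, map_pow, map_pow, ← s.degree_eq hd]
  simp only [Matrix.cons_val_zero, Matrix.cons_val_one, map_one, one_pow, mul_one]
  calc v ((s.form.coeff d : ℤ) : K) * v ζ ^ d 0 ≤ 1 * max (v ζ) 1 ^ d 0 := by
        gcongr
        exact le_max_left _ _
    _ ≤ max (v ζ) 1 ^ (d 0 + d 1) := by
        rw [one_mul]
        exact pow_le_pow_right₀ (le_max_right _ _) (Nat.le_add_right _ _)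

/-! ### Petersson norms -/

theorem petNorm_coe (s : IntegralSection) (ζ : ℂ) :
    s.petNorm (ζ : OnePoint ℂ) = ENNReal.ofReal (s.petNormUpper (jPreimage ζ)) := rfl

/-- Since c₄³ = Δ · j, homogeneity extracts the factor Δ^deg. -/
theorem petNormUpper_jPreimage (s : IntegralSection) (ζ : ℂ) :
    s.petNormUpper (jPreimage ζ) =
      ((4 * Real.pi * (jPreimage ζ).im) ^ 6 * ‖ModularForm.discriminant (jPreimage ζ)‖) ^ s.deg *
        ‖MvPolynomial.aeval ![ζ, 1] s.form‖ := by
  have hΔ := ModularForm.discriminant_ne_zero (jPreimage ζ)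
  have hj : (ModularForm.E₄ (jPreimage ζ)) ^ 3 = ModularForm.discriminant (jPreimage ζ) * ζ := by
    have := jInv_jPreimage ζ
    rw [jInv, div_eq_iff hΔ] at this
    rw [this, mul_comm]
  have h : ![(ModularForm.E₄ (jPreimage ζ)) ^ 3, ModularForm.discriminant (jPreimage ζ)] =
      ![ModularForm.discriminant (jPreimage ζ) * ζ,
        ModularForm.discriminant (jPreimage ζ) * 1] := by
    rw [hj, mul_one]
  rw [petNormUpper, h, aeval_form_mul, norm_mul, norm_pow, pow_mul, mul_pow]
  ring

theorem discriminantNorm_pos (τ : ℍ) :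
    0 < (4 * Real.pi * τ.im) ^ 6 * ‖ModularForm.discriminant τ‖ := by
  have := τ.im_pos
  have := norm_pos_iff.mpr (ModularForm.discriminant_ne_zero τ)
  positivity

theorem petNormUpper_jPreimage_pos (s : IntegralSection) (ζ : ℂ)
    (h : MvPolynomial.aeval ![ζ, 1] s.form ≠ 0) : 0 < s.petNormUpper (jPreimage ζ) := by
  rw [petNormUpper_jPreimage]
  exact mul_pos (pow_pos (discriminantNorm_pos _) _) (norm_pos_iff.mpr h)

theorem log_petNormUpper_jPreimage (s : IntegralSection) (ζ : ℂ)
    (h : MvPolynomial.aeval ![ζ, 1] s.form ≠ 0) :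
    Real.log (s.petNormUpper (jPreimage ζ)) =
      -(s.deg * gInf (jPreimage ζ)) + Real.log ‖MvPolynomial.aeval ![ζ, 1] s.form‖ := by
  rw [petNormUpper_jPreimage, Real.log_mul (pow_pos (discriminantNorm_pos _) _).ne'
    (norm_pos_iff.mpr h).ne', Real.log_pow, gInf]
  ring

end IntegralSection

/-! ### The height is independent of the number field -/

section Heights

variable {K : Type*} [Field K] [NumberField K]

/-- The form of Δ takes the value 1 at (ζ, 1), so only the denominators max(|ζ|_v, 1) and the metric
factor g_∞ remain. -/
theorem arakelovSum_delta (ζ : K) :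
    arakelovSum IntegralSection.delta ζ = 1 / (Module.finrank ℚ K : ℝ) *
      (∑ᶠ v : FinitePlace K, Real.log (max (v ζ) 1) +
        ∑ σ : K →+* ℂ, gInf (jPreimage (σ ζ))) := by
  have hcan : ∀ v : FinitePlace K,
      -Real.log (IntegralSection.delta.canNorm v (ζ : OnePoint K)) =
        Real.log (max (v ζ) 1) := by
    intro v
    have : IntegralSection.delta.canNorm v (ζ : OnePoint K) =
        v (MvPolynomial.aeval ![ζ, 1] IntegralSection.delta.form) / max (v ζ) (v 1) ^ 1 := rfl
    rw [this, IntegralSection.delta, MvPolynomial.aeval_X]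
    simp
  have hpet : ∀ σ : K →+* ℂ,
      -Real.log (IntegralSection.delta.petNorm ((σ ζ : ℂ) : OnePoint ℂ)).toReal =
        gInf (jPreimage (σ ζ)) := by
    intro σ
    have h1 : MvPolynomial.aeval ![σ ζ, 1] IntegralSection.delta.form = 1 := by
      simp [IntegralSection.delta]
    rw [IntegralSection.petNorm_coe, ENNReal.toReal_ofReal
      (IntegralSection.petNormUpper_jPreimage_pos _ _ (by rw [h1]; exact one_ne_zero)).le,
      IntegralSection.log_petNormUpper_jPreimage _ _ (by rw [h1]; exact one_ne_zero), h1]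
    simp [IntegralSection.delta]
  rw [arakelovSum, finsum_congr hcan, Finset.sum_congr rfl fun σ _ => hpet σ]

theorem arakelovSum_delta_algebraMap {L : Type*} [Field L] [NumberField L] [Algebra K L] (ζ : K) :
    arakelovSum IntegralSection.delta (algebraMap K L ζ) =
      arakelovSum IntegralSection.delta ζ := by
  have htower := Module.finrank_mul_finrank ℚ K L
  have hK : (Module.finrank ℚ K : ℝ) ≠ 0 := by exact_mod_cast Module.finrank_pos.ne'
  have hKL : (Module.finrank K L : ℝ) ≠ 0 := by
    have : Module.finrank ℚ L ≠ 0 := Module.finrank_pos.ne'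
    rw [← htower] at this
    exact_mod_cast right_ne_zero_of_mul this
  rw [arakelovSum_delta, arakelovSum_delta, finsum_log_max_one_algebraMap,
    sum_embeddings_algebraMap (fun z => gInf (jPreimage z)), ← htower, Nat.cast_mul, ← mul_add]
  field_simp

theorem faltingsHeightCurve_eq (E : WeierstrassCurve K) [E.IsElliptic] (hE : IsSemistable E) :
    faltingsHeightCurve E = 1 / 12 * arakelovSum IntegralSection.delta E.j := by
  rw [faltingsHeightCurve, log_absNorm_minimalDiscriminant E hE, arakelovSum_delta]
  simp_rw [periodPoint_eq, WeierstrassCurve.map_j]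
  ring

/-- The lower bound for the height given by one integral section. -/
theorem deg_mul_arakelovSum_ge (s : IntegralSection) (ζ : K)
    (h : MvPolynomial.aeval ![ζ, 1] s.form ≠ 0) :
    ∑ σ : K →+* ℂ, -Real.log (s.petNormUpper (jPreimage (σ ζ))) ≤
      s.deg * (Module.finrank ℚ K * arakelovSum IntegralSection.delta ζ) := by
  set p : K := MvPolynomial.aeval ![ζ, 1] s.form with hp
  have hσ : ∀ σ : K →+* ℂ, MvPolynomial.aeval ![σ ζ, 1] s.form = σ p :=
    fun σ => (s.map_aeval_form σ ζ).symm
  have hfin : ∑ᶠ v : FinitePlace K, Real.log (v p) ≤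
      s.deg * ∑ᶠ v : FinitePlace K, Real.log (max (v ζ) 1) := by
    rw [← Real.log_finprod fun v => FinitePlace.pos_iff.mpr h,
      ← Real.log_finprod fun _ => by positivity, ← Real.log_pow,
      finprod_pow (hasFiniteMulSupport_max_one ζ)]
    refine Real.log_le_log
      (finprod_induction (fun r : ℝ => 0 < r) one_pos (fun _ _ => mul_pos)
        fun v => FinitePlace.pos_iff.mpr h) ?_
    refine finprod_le_finprod (FinitePlace.hasFiniteMulSupport h) (fun v => apply_nonneg v p) ?_
      fun v => s.finitePlace_form_le v ζ
    exact (hasFiniteMulSupport_max_one ζ).subset fun v hv h1 => hv (by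
      simp [show max (v ζ) 1 = 1 from h1])
  -- The product formula turns -∑ log ‖σ p‖ into the finite sum bounded in `hfin`.
  have hprod := sum_log_finitePlace_add_sum_log_embeddings h
  have hK : (Module.finrank ℚ K : ℝ) ≠ 0 := by exact_mod_cast Module.finrank_pos.ne'
  rw [arakelovSum_delta, ← mul_assoc (Module.finrank ℚ K : ℝ), mul_one_div_cancel hK, one_mul,
    mul_add, Finset.mul_sum]
  have hterm : ∀ σ : K →+* ℂ, -Real.log (s.petNormUpper (jPreimage (σ ζ))) =
      s.deg * gInf (jPreimage (σ ζ)) - Real.log ‖σ p‖ := by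
    intro σ
    rw [s.log_petNormUpper_jPreimage _ (by rw [hσ]; simpa using h), hσ]
    ring
  rw [Finset.sum_congr rfl fun σ _ => hterm σ, Finset.sum_sub_distrib]
  linarith

end Heights

/-- Whichever L and E are chosen, L contains ℚ(x), and the Arakelov sum over L equals the one over
ℚ(x). -/
theorem faltingsHeight_eq (x : Qbar) : faltingsHeight x = 1 / 12 * arakelovHeight x := by
  have hspec := Classical.epsilon_spec (p := fun h : ℝ =>
    ∃ (L : IntermediateField ℚ Qbar) (_ : NumberField L) (E : WeierstrassCurve L)
      (_ : E.IsElliptic), IsSemistable E ∧ ((E.j : L) : Qbar) = x ∧ h = faltingsHeightCurve E) (by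
    obtain ⟨L, hL, E, hE, hs, hj⟩ := exists_semistable x
    exact ⟨_, L, hL, E, hE, hs, hj, rfl⟩)
  obtain ⟨L, hL, E, hE, hs, hj, h⟩ := hspec
  rw [show faltingsHeight x = _ from h, faltingsHeightCurve_eq E hs, arakelovHeight]
  congr 1
  have hle : IntermediateField.adjoin ℚ {x} ≤ L := by
    rw [IntermediateField.adjoin_simple_le_iff, ← hj]
    exact E.j.2
  let _ : Algebra (IntermediateField.adjoin ℚ {x}) L :=
    (IntermediateField.inclusion hle).toRingHom.toAlgebra
  rw [← arakelovSum_delta_algebraMap (L := L) (IntermediateField.AdjoinSimple.gen ℚ x)]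
  congr 1
  exact Subtype.ext hj

/-! ### Real sections -/

theorem RealSection.green_coe (s : RealSection) (ζ : ℂ)
    (h : ∀ k, MvPolynomial.aeval ![ζ, 1] (s.factor k).form ≠ 0) :
    s.green (ζ : OnePoint ℂ) =
      ((∑ k, s.exponent k * -Real.log ((s.factor k).petNormUpper (jPreimage ζ)) : ℝ) : EReal) := by
  have hpos := fun k => (s.factor k).petNormUpper_jPreimage_pos ζ (h k)
  have hnorm : s.petNorm (ζ : OnePoint ℂ) = ENNReal.ofReal
      (∏ k, (s.factor k).petNormUpper (jPreimage ζ) ^ s.exponent k) := by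
    rw [RealSection.petNorm, ENNReal.ofReal_prod_of_nonneg fun k _ =>
      (Real.rpow_pos_of_pos (hpos k) _).le]
    refine Finset.prod_congr rfl fun k _ => ?_
    rw [IntegralSection.petNorm_coe, ENNReal.ofReal_rpow_of_pos (hpos k)]
  rw [RealSection.green, hnorm, ENNReal.log_ofReal_of_pos
    (Finset.prod_pos fun k _ => Real.rpow_pos_of_pos (hpos k) _),
    Real.log_prod fun k _ => (Real.rpow_pos_of_pos (hpos k) _).ne', ← EReal.coe_neg,
    ← Finset.sum_neg_distrib]
  congr 1
  refine Finset.sum_congr rfl fun k _ => ?_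
  rw [Real.log_rpow (hpos k), mul_neg]

theorem iInf_green_le_faltingsHeight (s : RealSection) (hs : s.weight = 1) (x : Qbar)
    (hx : (x : OnePoint Qbar) ∉ s.support) :
    (⨅ y : OnePoint ℂ, s.green y) ≤ (faltingsHeight x : EReal) := by
  let K := IntermediateField.adjoin ℚ {x}
  let ζ : K := IntermediateField.AdjoinSimple.gen ℚ x
  have hζ : ∀ k, MvPolynomial.aeval ![ζ, 1] (s.factor k).form ≠ 0 := by
    intro k h
    refine hx (Set.mem_iUnion.mpr ⟨k, ?_⟩)
    change MvPolynomial.aeval ![x, 1] (s.factor k).form = 0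
    have := (s.factor k).map_aeval_form (algebraMap K Qbar) ζ
    rw [h, map_zero] at this
    exact this.symm
  have hσ : ∀ (σ : K →+* ℂ) k, MvPolynomial.aeval ![σ ζ, 1] (s.factor k).form ≠ 0 := by
    intro σ k
    rw [← IntegralSection.map_aeval_form, map_ne_zero]
    exact hζ k
  have hw : ∑ k, s.exponent k * ((s.factor k).deg : ℝ) = 1 / 12 := by
    rw [RealSection.weight] at hs
    linarith
  have hsum : ∑ σ : K →+* ℂ, ∑ k, s.exponent k *
      -Real.log ((s.factor k).petNormUpper (jPreimage (σ ζ))) ≤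
        ∑ _σ : K →+* ℂ, faltingsHeight x := by
    rw [Finset.sum_comm, Finset.sum_const, Finset.card_univ, Embeddings.card, nsmul_eq_mul,
      faltingsHeight_eq, ← hw, Finset.sum_mul, Finset.mul_sum]
    refine Finset.sum_le_sum fun k _ => ?_
    rw [← Finset.mul_sum]
    refine (mul_le_mul_of_nonneg_left (deg_mul_arakelovSum_ge (s.factor k) ζ (hζ k))
      (s.exponent_pos k).le).trans_eq ?_
    rw [arakelovHeight]
    ring
  -- The average of g_s over the embeddings is at most h_F(x), so one of its terms is.
  obtain ⟨σ, -, hle⟩ := Finset.exists_le_of_sum_le Finset.univ_nonempty hsum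
  refine (iInf_le _ ((σ ζ : ℂ) : OnePoint ℂ)).trans ?_
  rw [s.green_coe _ (hσ σ)]
  exact_mod_cast hle

/-- The map -log is an order-reversing bijection from [0, ∞] to [-∞, ∞]. -/
theorem iInf_green_eq (s : RealSection) :
    (⨅ y : OnePoint ℂ, s.green y) = -ENNReal.log (⨆ y : OnePoint ℂ, s.petNorm y) := by
  have h1 : ENNReal.log (⨆ y : OnePoint ℂ, s.petNorm y) = ⨆ y, ENNReal.log (s.petNorm y) :=
    ENNReal.logOrderIso.map_iSup _
  rw [h1]
  exact (EReal.negOrderIso.map_iSup fun y => ENNReal.log (s.petNorm y)).symm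

theorem iInf_green_le_essentialMinimum (s : RealSection) (hs : s.weight = 1) :
    (⨅ y : OnePoint ℂ, s.green y) ≤ essentialMinimum := by
  refine le_sInf ?_
  rintro _ ⟨θ, hθ, rfl⟩
  have hfin : {x : Qbar | (x : OnePoint Qbar) ∈ s.support}.Finite := by
    refine (Set.finite_iUnion fun k => (s.factor k).finite_zeros).subset fun x hx => ?_
    simpa [RealSection.support] using hx
  obtain ⟨x, hx, hxs⟩ := (Set.Infinite.sdiff hθ hfin).nonempty
  exact (iInf_green_le_faltingsHeight s hs x hxs).trans (EReal.coe_le_coe_iff.mpr hx)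

end FaltingsEssMin

end

theorem mainTheorem10 (s : FaltingsEssMin.RealSection) (hs : s.weight = 1) :
    (∀ x : FaltingsEssMin.Qbar, (x : OnePoint FaltingsEssMin.Qbar) ∉ s.support →
      FaltingsEssMin.faltingsHeight x = 1 / 12 * FaltingsEssMin.arakelovHeight x ∧
        (⨅ y : OnePoint ℂ, s.green y) ≤ (FaltingsEssMin.faltingsHeight x : EReal)) ∧
      (⨅ y : OnePoint ℂ, s.green y) = -ENNReal.log (⨆ y : OnePoint ℂ, s.petNorm y) ∧
      (⨅ y : OnePoint ℂ, s.green y) ≤ FaltingsEssMin.essentialMinimum :=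
  ⟨fun x hx => ⟨FaltingsEssMin.faltingsHeight_eq x,
    FaltingsEssMin.iInf_green_le_faltingsHeight s hs x hx⟩,
    FaltingsEssMin.iInf_green_eq s, FaltingsEssMin.iInf_green_le_essentialMinimum s hs⟩
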